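/- Let $\mathbf{D}=\{z\in\mathbf{C}:|z|\le 1\}$, let $d\ge 0$ and $K\ge 2$ be integers and let $\eta>0$. There is a constant $C_3(d,K,\eta)$, depending only on $d,K,\eta$, and for every $\varepsilon>0$ there is a constant $C_2(d,K,\eta,\varepsilon)$, depending only on $d,K,\eta,\varepsilon$, such that the following holds. For every $n$ and all sets $Z_1,\dots,Z_n\subset\mathbf{D}$ with $|Z_j|=K$ and $|z-z'|\ge\eta$ for all distinct $z,z'\in Z_j$, $1\le j\le n$, there is a subset $Y_n\subset\prod_{j=1}^nZ_j$ with $$|Y_n|\le \max\Big\{1,\frac{d}{\varepsilon}\Big\}^{100d}(1+\varepsilon)^n$$ such that every analytic polynomial $f$ in $n$ complex variables, of total degree at most $d$ and of degree at most $K-1$ in each variable, satisfies $$\sup_{z\in\mathbf{D}^n}|f(z)|\le C_2(d,K,\eta,\varepsilon)\,\max_{y\in Y_n}|f(y)| .$$ Furthermore, if $0<\varepsilon\le 1/2$, then $$C_2(d,K,\eta,\varepsilon)\le\exp\Big(C_3(d,K,\eta)\,\big(\varepsilon^{-1}\log(\varepsilon^{-1})\big)^d\Big).$$ -/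

import Mathlib

/-- The closed polydisc `𝐃ⁿ`, where `𝐃 = {z ∈ ℂ : |z| ≤ 1}`. -/
def polydisc (n : ℕ) : Set (Fin n → ℂ) := {z | ∀ j, ‖z j‖ ≤ 1}

/-- The uniform norm `‖f‖_S = sup_{z ∈ S} |f(z)|` of a polynomial in `n` complex variables over a
set `S` of points. It is only used for the (compact, non-empty) polydisc and for finite `S`, where
the supremum is that of a bounded set; for `S = ∅` its value is `0`. -/
noncomputable def uniformNorm {n : ℕ} (S : Set (Fin n → ℂ)) (f : MvPolynomial (Fin n) ℂ) : ℝ :=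
  ⨆ z : S, ‖MvPolynomial.eval (z : Fin n → ℂ) f‖

/-! The polydisc is first replaced by `∏ Z_j` at a cost independent of `n`. Products of Lagrange
weights on the `Z_j` represent evaluation at `z`, but they are complex and their total variation can
grow exponentially with `n`. A small perturbation of the uniform measure on each `Z_j` towards the
real and imaginary parts of the weights is still a probability measure, so the integral of `f`
against the product is bounded by its maximum. That integral has degree at most `d` in each
perturbation parameter, hence extrapolates to the Lagrange weights with a constant free of `n`
(`exists_discretization_const`).

The product set is then thinned in one of two ways. For large `n`, group the coordinates into `M`
blocks and mix `x` blockwise with a base point. The value of `f` at the mix is a set function of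
degree at most `d`, so it is controlled by mixes taking at most `d` blocks from `x`
(`exists_block_norming_const`). For small `ε`, taking `M` of order `1/ε` leaves at most `(1 + ε)^n`
points once `n ≥ N`, with `N` of order `ε⁻¹ log ε⁻¹`. For `n < N`, a norming set with at most as
many points as the dimension suffices (`exists_norming_subset`). Its constant is exponential in the
dimension, which is at most `(N + 1)^d`; this gives the exponent in `C₂`. -/

/-! ### Discretization of the polydisc by product sets -/

/-- Extrapolation of bounded univariate polynomials from a real interval to a fixed point. -/
theorem exists_extrapolation_bound (d : ℕ) {r : ℝ} (hr : 0 < r) (ζ : ℂ) :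
    ∃ C : ℝ, 0 ≤ C ∧ ∀ p : Polynomial ℂ, p.natDegree ≤ d → ∀ M : ℝ,
      (∀ t : ℝ, 0 ≤ t → t ≤ r → ‖p.eval (t : ℂ)‖ ≤ M) → ‖p.eval ζ‖ ≤ C * M := by
  classical
  let v : Fin (d + 1) → ℂ := fun i => ((r * (i : ℝ) / (d + 1) : ℝ) : ℂ)
  have hv : Function.Injective v := by
    intro i j hij
    have h1 : r * (i : ℝ) / (d + 1) = r * (j : ℝ) / (d + 1) := Complex.ofReal_injective hij
    have hd : (d : ℝ) + 1 ≠ 0 := by positivity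
    have h2 : (i : ℝ) = j := by
      field_simp at h1
      exact h1
    exact Fin.ext (by exact_mod_cast h2)
  refine ⟨∑ i, ‖(Lagrange.basis Finset.univ v i).eval ζ‖,
    Finset.sum_nonneg fun _ _ => norm_nonneg _, fun p hp M hM => ?_⟩
  have hdeg : p.degree < (Finset.univ : Finset (Fin (d + 1))).card := by
    refine lt_of_le_of_lt Polynomial.degree_le_natDegree ?_
    rw [Finset.card_univ, Fintype.card_fin]
    exact_mod_cast Nat.lt_succ_of_le hp
  have hpe := Lagrange.eq_interpolate (s := Finset.univ) (v := v) hv.injOn hdeg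
  have heval : p.eval ζ = ∑ i, p.eval (v i) * (Lagrange.basis Finset.univ v i).eval ζ := by
    conv_lhs => rw [hpe, Lagrange.interpolate_apply]
    simp [Polynomial.eval_finsetSum]
  rw [heval, Finset.sum_mul]
  refine norm_sum_le_of_le _ fun i _ => ?_
  rw [norm_mul, mul_comm]
  refine mul_le_mul_of_nonneg_left (hM _ (by positivity) ?_) (norm_nonneg _)
  have hi : (i : ℝ) ≤ d + 1 := by exact_mod_cast i.2.le
  rw [div_le_iff₀ (by positivity)]
  exact mul_le_mul_of_nonneg_left hi hr.le

/-- Integrating a polynomial against a product of weights splits over its monomials. -/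
theorem sum_piFinset_prod_mul_eval {n : ℕ} (Z : Fin n → Finset ℂ) (w : Fin n → ℂ → ℂ)
    (f : MvPolynomial (Fin n) ℂ) :
    ∑ x ∈ Fintype.piFinset Z, (∏ j, w j (x j)) * MvPolynomial.eval x f =
      ∑ m ∈ f.support, f.coeff m * ∏ j, ∑ x ∈ Z j, w j x * x ^ m j := by
  simp_rw [MvPolynomial.eval_eq', Finset.mul_sum]
  rw [Finset.sum_comm]
  refine Finset.sum_congr rfl fun m _ => ?_
  rw [Finset.prod_univ_sum, Finset.mul_sum]
  refine Finset.sum_congr rfl fun x _ => ?_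
  rw [Finset.prod_mul_distrib]
  ring

theorem sum_apply_le_totalDegree {n : ℕ} {f : MvPolynomial (Fin n) ℂ} {m : Fin n →₀ ℕ}
    (hm : m ∈ f.support) : ∑ j, m j ≤ f.totalDegree := by
  have h := MvPolynomial.le_totalDegree hm
  rwa [Finsupp.sum_fintype _ _ fun _ => rfl] at h

/-- The integral of a polynomial of total degree at most `d` against a product of weights that
depend affinely on `t`, with constant total mass, is a polynomial of degree at most `d` in `t`. -/
theorem exists_polynomial_affine_weights {n : ℕ} (Z : Fin n → Finset ℂ) (α β : Fin n → ℂ → ℂ)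
    (hβ : ∀ j, ∑ x ∈ Z j, β j x = 0) (f : MvPolynomial (Fin n) ℂ) :
    ∃ p : Polynomial ℂ, p.natDegree ≤ f.totalDegree ∧ ∀ t : ℂ, p.eval t =
      ∑ x ∈ Fintype.piFinset Z, (∏ j, (α j (x j) + t * β j (x j))) * MvPolynomial.eval x f := by
  refine ⟨∑ m ∈ f.support, Polynomial.C (f.coeff m) * ∏ j,
    (Polynomial.C (∑ x ∈ Z j, α j x * x ^ m j) +
      Polynomial.C (∑ x ∈ Z j, β j x * x ^ m j) * Polynomial.X), ?_, fun t => ?_⟩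
  · refine Polynomial.natDegree_sum_le_of_forall_le _ _ fun m hm => ?_
    refine (Polynomial.natDegree_C_mul_le _ _).trans ?_
    refine (Polynomial.natDegree_prod_le _ _).trans ?_
    refine le_trans (Finset.sum_le_sum fun j _ => ?_) (sum_apply_le_totalDegree hm)
    -- Constant total mass makes the factor of an absent variable free of `t`, so only the at most
    -- `d` variables of the monomial contribute to the degree.
    rcases Nat.eq_zero_or_pos (m j) with h0 | h0
    · simp [h0, hβ, -map_sum]
    · refine le_trans ?_ h0
      rw [add_comm]
      exact Polynomial.natDegree_linear_le
  · rw [sum_piFinset_prod_mul_eval Z (fun j x => α j x + t * β j x) f]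
    simp only [Polynomial.eval_finsetSum, Polynomial.eval_mul, Polynomial.eval_C,
      Polynomial.eval_prod, Polynomial.eval_add, Polynomial.eval_X]
    refine Finset.sum_congr rfl fun m _ => ?_
    congr 1
    refine Finset.prod_congr rfl fun j _ => ?_
    simp only [add_mul, Finset.sum_add_distrib, mul_assoc, Finset.sum_mul]
    congr 1
    exact Finset.sum_congr rfl fun x _ => by ring

/-- Averages against product probability weights are bounded by the maximum. -/
theorem norm_sum_piFinset_le {n : ℕ} (Z : Fin n → Finset ℂ) (w : Fin n → ℂ → ℝ)
    (hw : ∀ j, ∀ x ∈ Z j, 0 ≤ w j x) (hw1 : ∀ j, ∑ x ∈ Z j, w j x = 1)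
    (g : (Fin n → ℂ) → ℂ) (M : ℝ) (hM : ∀ x ∈ Fintype.piFinset Z, ‖g x‖ ≤ M) :
    ‖∑ x ∈ Fintype.piFinset Z, (∏ j, (w j (x j) : ℂ)) * g x‖ ≤ M := by
  have h1 : ∑ x ∈ Fintype.piFinset Z, ∏ j, w j (x j) = 1 := by
    rw [← Finset.prod_univ_sum]
    simp [hw1]
  calc _ ≤ ∑ x ∈ Fintype.piFinset Z, (∏ j, w j (x j)) * M := by
        refine norm_sum_le_of_le _ fun x hx => ?_
        have hx' := Fintype.mem_piFinset.1 hx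
        rw [← Complex.ofReal_prod, norm_mul, Complex.norm_real, Real.norm_of_nonneg
          (Finset.prod_nonneg fun j _ => hw j _ (hx' j))]
        exact mul_le_mul_of_nonneg_left (hM x hx) (Finset.prod_nonneg fun j _ => hw j _ (hx' j))
    _ = M := by rw [← Finset.sum_mul, h1, one_mul]

/-- Lagrange weights of a point of the unit disc with respect to separated nodes. -/
theorem exists_lagrange_weights {K : ℕ} (hK : 1 ≤ K) {η : ℝ} (hη : 0 < η) (Z : Finset ℂ)
    (hZ : ∀ z ∈ Z, ‖z‖ ≤ 1) (hcard : Z.card = K)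
    (hsep : ∀ z ∈ Z, ∀ z' ∈ Z, z ≠ z' → η ≤ ‖z - z'‖) {ζ : ℂ} (hζ : ‖ζ‖ ≤ 1) :
    ∃ w : ℂ → ℂ, (∀ x ∈ Z, ‖w x‖ ≤ (2 / η) ^ (K - 1)) ∧
      ∀ k ≤ K - 1, ∑ x ∈ Z, w x * x ^ k = ζ ^ k := by
  classical
  refine ⟨fun x => (Lagrange.basis Z id x).eval ζ, fun x hx => ?_, fun k hk => ?_⟩
  · simp only [Lagrange.basis, Polynomial.eval_prod, norm_prod, id]
    rw [← hcard, ← Finset.card_erase_of_mem hx, ← Finset.prod_const]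
    refine Finset.prod_le_prod (fun _ _ => norm_nonneg _) fun y hy => ?_
    have hyx := Finset.ne_of_mem_erase hy
    have hyZ := Finset.mem_of_mem_erase hy
    simp only [Lagrange.basisDivisor, Polynomial.eval_mul, Polynomial.eval_C, Polynomial.eval_sub,
      Polynomial.eval_X, norm_mul, norm_inv]
    have h1 := hsep x hx y hyZ hyx.symm
    have h2 : ‖ζ - y‖ ≤ 2 := (norm_sub_le _ _).trans (by linarith [hZ y hyZ])
    rw [div_eq_inv_mul]
    exact mul_le_mul (inv_anti₀ hη h1) h2 (norm_nonneg _) (by positivity)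
  · have hdeg : (Polynomial.X ^ k : Polynomial ℂ).degree < Z.card := by
      rw [Polynomial.degree_X_pow]
      exact_mod_cast (by omega : k < Z.card)
    have h := Lagrange.eq_interpolate (s := Z) (v := id) (Set.injOn_id _) hdeg
    have h2 := congrArg (Polynomial.eval ζ) h
    rw [Lagrange.interpolate_apply, Polynomial.eval_finsetSum] at h2
    simp only [Polynomial.eval_pow, Polynomial.eval_X, id, Polynomial.eval_mul,
      Polynomial.eval_C] at h2
    rw [h2]
    exact Finset.sum_congr rfl fun x _ => mul_comm _ _

/-- Dimension-free discretization of the uniform norm on the polydisc by product sets. -/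
theorem exists_discretization_const (d K : ℕ) (hK : 1 ≤ K) {η : ℝ} (hη : 0 < η) :
    ∃ A : ℝ, 0 ≤ A ∧ ∀ (n : ℕ) (Z : Fin n → Finset ℂ),
      (∀ j, ∀ z ∈ Z j, ‖z‖ ≤ 1) → (∀ j, (Z j).card = K) →
      (∀ j, ∀ z ∈ Z j, ∀ z' ∈ Z j, z ≠ z' → η ≤ ‖z - z'‖) →
      ∀ f : MvPolynomial (Fin n) ℂ, f.totalDegree ≤ d → (∀ j, f.degreeOf j ≤ K - 1) →
      ∀ M : ℝ, (∀ x ∈ Fintype.piFinset Z, ‖MvPolynomial.eval x f‖ ≤ M) →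
      ∀ z ∈ polydisc n, ‖MvPolynomial.eval z f‖ ≤ A * M := by
  set R : ℝ := (2 / η) ^ (K - 1) with hR
  have hR0 : 0 < R := by positivity
  have hKpos : (0 : ℝ) < K := by exact_mod_cast hK
  have hKinv : (K : ℝ)⁻¹ ≤ 1 := inv_le_one_of_one_le₀ (by exact_mod_cast hK)
  -- For `s, t ∈ [0, r]` the two perturbations lower a weight by at most `r * R` and `r * (R + 1)`,
  -- together exactly the uniform mass `1 / K`.
  set r : ℝ := (K * (2 * R + 1))⁻¹ with hr
  have hr0 : 0 < r := by positivity
  have hrR : r * (2 * R + 1) = (K : ℝ)⁻¹ := by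
    rw [hr]; field_simp
  obtain ⟨A₁, hA₁, h₁⟩ := exists_extrapolation_bound d hr0 1
  obtain ⟨A₂, hA₂, h₂⟩ := exists_extrapolation_bound d hr0 Complex.I
  refine ⟨A₂ * A₁, by positivity, fun n Z hZ hcard hsep f hfd hfK M hM z hz => ?_⟩
  choose w hwR hw using fun j => exists_lagrange_weights hK hη (Z j) (hZ j) (hcard j) (hsep j) (hz j)
  have hw1 : ∀ j, ∑ x ∈ Z j, w j x = 1 := fun j => by simpa using hw j 0 (Nat.zero_le _)
  have hre : ∀ j, ∑ x ∈ Z j, (w j x).re = 1 := fun j => by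
    rw [← Complex.re_sum, hw1, Complex.one_re]
  have him : ∀ j, ∑ x ∈ Z j, (w j x).im = 0 := fun j => by
    rw [← Complex.im_sum, hw1, Complex.one_im]
  have hunif : ∀ j, ∑ _x ∈ Z j, (K : ℝ)⁻¹ = 1 := fun j => by
    rw [Finset.sum_const, hcard, nsmul_eq_mul, mul_inv_cancel₀ hKpos.ne']
  have hβ : ∀ j, ∑ x ∈ Z j, ((w j x).re - (K : ℝ)⁻¹) = 0 := fun j => by
    rw [Finset.sum_sub_distrib, hre, hunif, sub_self]
  -- extrapolation to the real parts of the weights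
  have step₁ : ∀ s : ℝ, 0 ≤ s → s ≤ r →
      ‖∑ x ∈ Fintype.piFinset Z, (∏ j, (((w j (x j)).re : ℂ) + s * ((w j (x j)).im : ℂ))) *
        MvPolynomial.eval x f‖ ≤ A₁ * M := by
    intro s hs0 hsr
    obtain ⟨p, hpd, hp⟩ := exists_polynomial_affine_weights Z
      (fun j x => (((K : ℝ)⁻¹ + s * (w j x).im : ℝ) : ℂ))
      (fun j x => (((w j x).re - (K : ℝ)⁻¹ : ℝ) : ℂ))
      (fun j => by rw [← Complex.ofReal_sum, hβ, Complex.ofReal_zero]) f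
    have key := h₁ p (hpd.trans hfd) M fun t ht0 htr => by
      rw [hp]
      have := norm_sum_piFinset_le Z
        (fun j x => (K : ℝ)⁻¹ + s * (w j x).im + t * ((w j x).re - (K : ℝ)⁻¹))
        (fun j x hx => ?_) (fun j => ?_) (fun x => MvPolynomial.eval x f) M hM
      · refine le_trans (le_of_eq ?_) this
        push_cast
        rfl
      · have b1 := abs_le.1 ((Complex.abs_re_le_norm _).trans (hwR j x hx))
        have b2 := abs_le.1 ((Complex.abs_im_le_norm _).trans (hwR j x hx))
        have c1 : -(r * R) ≤ s * (w j x).im := by nlinarith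
        have c2 : -(r * (R + 1)) ≤ t * ((w j x).re - (K : ℝ)⁻¹) := by nlinarith
        linarith
      · rw [Finset.sum_add_distrib, Finset.sum_add_distrib, ← Finset.mul_sum, ← Finset.mul_sum,
          him, hβ, hunif]
        ring
    rw [hp] at key
    refine le_trans (le_of_eq ?_) key
    congr 1
    refine Finset.sum_congr rfl fun x _ => ?_
    congr 1
    refine Finset.prod_congr rfl fun j _ => ?_
    push_cast
    ring
  -- With `t` already moved to `1`, moving `s` to `I` turns `re + s * im` into the Lagrange weight
  -- itself.
  obtain ⟨p, hpd, hp⟩ := exists_polynomial_affine_weights Z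
    (fun j x => ((w j x).re : ℂ)) (fun j x => ((w j x).im : ℂ))
    (fun j => by rw [← Complex.ofReal_sum, him, Complex.ofReal_zero]) f
  have key := h₂ p (hpd.trans hfd) (A₁ * M) fun t ht0 htr => by
    rw [hp]
    exact step₁ t ht0 htr
  rw [hp] at key
  rw [mul_assoc]
  refine le_trans (le_of_eq ?_) key
  congr 1
  have e : ∀ x : Fin n → ℂ, (∏ j, (((w j (x j)).re : ℂ) + Complex.I * ((w j (x j)).im : ℂ))) =
      ∏ j, w j (x j) := fun x => Finset.prod_congr rfl fun j _ => by
    rw [mul_comm, Complex.re_add_im]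
  simp_rw [e]
  rw [sum_piFinset_prod_mul_eval Z w f, MvPolynomial.eval_eq']
  refine Finset.sum_congr rfl fun m hm => ?_
  congr 1
  refine Finset.prod_congr rfl fun j _ => ?_
  exact (hw j (m j) ((MvPolynomial.monomial_le_degreeOf j hm).trans (hfK j))).symm

/-! ### Norming sets of cardinality at most the dimension -/

/-- A finite-dimensional space of functions admits, in every finite set `X`, a norming subset with
at most as many points as the dimension. -/
theorem exists_norming_subset {α : Type*} [DecidableEq α] (X : Finset α) (N : ℕ)
    (V : Submodule ℂ (α → ℂ)) [FiniteDimensional ℂ V] (hV : Module.finrank ℂ V ≤ N) :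
    ∃ Y ⊆ X, Y.card ≤ N ∧ ∀ f ∈ V, ∀ M : ℝ, 0 ≤ M → (∀ y ∈ Y, ‖f y‖ ≤ M) →
      ∀ x ∈ X, ‖f x‖ ≤ (2 ^ N - 1 : ℝ) * M := by
  induction N generalizing V with
  | zero =>
    have hbot : V = ⊥ := Submodule.finrank_eq_zero.1 (Nat.le_zero.1 hV)
    refine ⟨∅, Finset.empty_subset _, le_rfl, fun f hf M _ _ x _ => ?_⟩
    rw [hbot, Submodule.mem_bot] at hf
    simp [hf]
  | succ N ih =>
    have hpow : (1 : ℝ) ≤ 2 ^ N := one_le_pow₀ (by norm_num)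
    by_cases hvan : ∀ f ∈ V, ∀ x ∈ X, f x = 0
    · refine ⟨∅, Finset.empty_subset _, Nat.zero_le _, fun f hf M hM _ x hx => ?_⟩
      rw [hvan f hf x hx, norm_zero]
      refine mul_nonneg ?_ hM
      rw [pow_succ]
      linarith
    push Not at hvan
    obtain ⟨g, hg, x₁, hx₁, hgx₁⟩ := hvan
    -- Since `|g|` peaks at `x₀`, subtracting the multiple of `g` that kills `f x₀` changes `f` by
    -- at most `M` on all of `X`. The constant then obeys `2 * (2 ^ N - 1) + 1 = 2 ^ (N + 1) - 1`.
    obtain ⟨x₀, hx₀, hmax⟩ := X.exists_max_image (fun x => ‖g x‖) ⟨x₁, hx₁⟩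
    have hgx₀ : g x₀ ≠ 0 := fun h => by
      have := hmax x₁ hx₁
      rw [h, norm_zero] at this
      exact hgx₁ (norm_le_zero_iff.1 this)
    let W : Submodule ℂ (α → ℂ) := V ⊓ LinearMap.ker (LinearMap.proj (R := ℂ) (φ := fun _ => ℂ) x₀)
    have hWV : W < V := by
      refine lt_of_le_of_ne inf_le_left fun h => hgx₀ ?_
      have : g ∈ W := h ▸ hg
      exact this.2
    have : FiniteDimensional ℂ W := Submodule.finiteDimensional_of_le hWV.le
    obtain ⟨Y, hYX, hYN, hY⟩ := ih W
      (Nat.lt_succ_iff.1 ((Submodule.finrank_lt_finrank_of_lt hWV).trans_le hV))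
    refine ⟨insert x₀ Y, Finset.insert_subset hx₀ hYX,
      (Finset.card_insert_le _ _).trans (Nat.succ_le_succ hYN), fun f hf M hM hfM x hx => ?_⟩
    have hf₀ : ‖f x₀‖ ≤ M := hfM _ (Finset.mem_insert_self _ _)
    have hterm : ∀ y ∈ X, ‖(f x₀ / g x₀) * g y‖ ≤ M := fun y hy => by
      rw [norm_mul, norm_div, div_mul_eq_mul_div, div_le_iff₀ (norm_pos_iff.2 hgx₀)]
      exact mul_le_mul hf₀ (hmax y hy) (norm_nonneg _) hM
    have hh : f - (f x₀ / g x₀) • g ∈ W := by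
      refine ⟨V.sub_mem hf (V.smul_mem _ hg), ?_⟩
      simp [hgx₀]
    have key := hY _ hh (2 * M) (by positivity) (fun y hy => by
      refine (norm_sub_le _ _).trans ?_
      have h1 := hfM y (Finset.mem_insert_of_mem hy)
      have h2 := hterm y (hYX hy)
      simp only [Pi.smul_apply, smul_eq_mul]
      linarith) x hx
    have h3 := hterm x hx
    have h4 : ‖f x‖ ≤ ‖(f - (f x₀ / g x₀) • g) x‖ + ‖(f x₀ / g x₀) * g x‖ := by
      refine le_trans (le_of_eq ?_) (norm_add_le _ _)
      simp
    rw [pow_succ]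
    linarith

/-- The space of polynomial functions of total degree at most `d` in `n` variables has norming
subsets with at most `(n + d).choose n` points in every finite set. -/
theorem exists_norming_subset_totalDegree {n : ℕ} (d : ℕ) (X : Finset (Fin n → ℂ)) :
    ∃ Y ⊆ X, Y.card ≤ (d + n).choose n ∧ ∀ f : MvPolynomial (Fin n) ℂ, f.totalDegree ≤ d →
      ∀ M : ℝ, 0 ≤ M → (∀ y ∈ Y, ‖MvPolynomial.eval y f‖ ≤ M) →
      ∀ x ∈ X, ‖MvPolynomial.eval x f‖ ≤ 2 ^ (d + n).choose n * M := by
  classical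
  let I : Finset (Fin n →₀ ℕ) :=
    (Finset.range (d + 1)).biUnion fun k => Finset.finsuppAntidiag Finset.univ k
  have hI : I.card ≤ (d + n).choose n := by
    refine Finset.card_biUnion_le.trans ?_
    simp_rw [Finset.card_finsuppAntidiag_nat_eq_multichoose]
    rw [Finset.card_univ, Fintype.card_fin, Nat.sum_range_multichoose]
  let F : Finset ((Fin n → ℂ) → ℂ) := I.image fun m x => ∏ j, x j ^ m j
  have hF : Module.finrank ℂ (Submodule.span ℂ (F : Set ((Fin n → ℂ) → ℂ))) ≤ (d + n).choose n :=
    (finrank_span_finset_le_card F).trans (Finset.card_image_le.trans hI)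
  have : FiniteDimensional ℂ (Submodule.span ℂ (F : Set ((Fin n → ℂ) → ℂ))) :=
    FiniteDimensional.span_finset ℂ F
  obtain ⟨Y, hYX, hYc, hY⟩ := exists_norming_subset X _ _ hF
  refine ⟨Y, hYX, hYc, fun f hf M hM hfM x hx => ?_⟩
  have hmem : (fun x => MvPolynomial.eval x f) ∈
      Submodule.span ℂ (F : Set ((Fin n → ℂ) → ℂ)) := by
    have : (fun x => MvPolynomial.eval x f) =
        ∑ m ∈ f.support, f.coeff m • fun x : Fin n → ℂ => ∏ j, x j ^ m j := by
      funext x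
      rw [MvPolynomial.eval_eq', Finset.sum_apply]
      simp
    rw [this]
    refine Submodule.sum_mem _ fun m hm => Submodule.smul_mem _ _ (Submodule.subset_span ?_)
    refine Finset.mem_coe.2 (Finset.mem_image_of_mem _ (Finset.mem_biUnion.2 ⟨∑ j, m j, ?_, ?_⟩))
    · have h := MvPolynomial.le_totalDegree hm
      rw [Finsupp.sum_fintype _ _ fun _ => rfl] at h
      exact Finset.mem_range.2 (Nat.lt_succ_of_le (h.trans hf))
    · simp
  refine (hY _ hmem M hM hfM x hx).trans (mul_le_mul_of_nonneg_right ?_ hM)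
  linarith

/-! ### Counting estimates -/

theorem choose_add_le_pow (n d : ℕ) : (d + n).choose n ≤ (n + 1) ^ d := by
  induction d with
  | zero => simp
  | succ d ih =>
    have h : (d + n + 1).choose n * (d + 1) = (d + n).choose n * (d + n + 1) := by
      have := Nat.choose_mul_succ_eq (d + n) n
      rw [show d + n + 1 - n = d + 1 by omega] at this
      linarith
    have h2 : (d + n + 1).choose n * (d + 1) ≤ (n + 1) ^ (d + 1) * (d + 1) := by
      rw [h, pow_succ, mul_assoc]
      exact Nat.mul_le_mul ih (by nlinarith)
    rw [show d + 1 + n = d + n + 1 by omega]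
    exact Nat.le_of_mul_le_mul_right h2 (Nat.succ_pos d)

/-- Consecutive binomials have ratio `1 + d / (n + 1)`, at most `1 + ε` once `d / ε ≤ n + 1`. Below
that range a crude power bound is absorbed by the maximum. -/
theorem choose_add_le_max_pow_mul (d n : ℕ) {ε : ℝ} (hε : 0 < ε) :
    ((d + n).choose n : ℝ) ≤ max 1 ((d : ℝ) / ε) ^ (2 * d) * (1 + ε) ^ n := by
  set q : ℝ := (d : ℝ) / ε with hq
  have hqε : q * ε = d := by rw [hq]; field_simp
  have hm1 : 1 ≤ max 1 q := le_max_left _ _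
  have hmp : 1 ≤ max 1 q ^ (2 * d) := one_le_pow₀ hm1
  -- the estimate persists once `q ≤ n + 1`
  have hstep : ∀ n : ℕ, q ≤ n + 1 →
      ((d + n).choose n : ℝ) ≤ max 1 q ^ (2 * d) * (1 + ε) ^ n →
      ((d + (n + 1)).choose (n + 1) : ℝ) ≤ max 1 q ^ (2 * d) * (1 + ε) ^ (n + 1) := by
    intro n hn ih
    have h : ((d + n + 1 : ℕ) : ℝ) * ((d + n).choose n : ℝ) =
        ((d + (n + 1)).choose (n + 1) : ℝ) * ((n : ℝ) + 1) := by
      exact_mod_cast Nat.add_one_mul_choose_eq (d + n) n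
    push_cast at h
    have hd : (d : ℝ) + n + 1 ≤ (1 + ε) * (n + 1) := by nlinarith
    have hpos : (0 : ℝ) < (n : ℝ) + 1 := by positivity
    refine le_of_mul_le_mul_right ?_ hpos
    rw [← h, pow_succ]
    calc ((d : ℝ) + n + 1) * ((d + n).choose n : ℝ)
        ≤ ((1 + ε) * (n + 1)) * (max 1 q ^ (2 * d) * (1 + ε) ^ n) :=
          mul_le_mul hd ih (Nat.cast_nonneg _) (by positivity)
      _ = _ := by ring
  induction n with
  | zero => simpa using hmp
  | succ n ih =>
    by_cases hn : q ≤ n + 1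
    · exact hstep n hn ih
    push Not at hn
    have hq1 : 1 < q := lt_of_le_of_lt (by simp) hn
    rw [max_eq_right hq1.le]
    have hd1 : 1 ≤ d := by
      rcases Nat.eq_zero_or_pos d with h0 | h0
      · rw [hq, h0] at hq1; norm_num at hq1
      · exact h0
    have hεp : (1 : ℝ) ≤ (1 + ε) ^ (n + 1) := one_le_pow₀ (by linarith)
    -- The comparison `n + 2 ≤ (n + 1) ^ 2 ≤ q ^ 2` fails at `n = 0`, where instead `d + 1 ≤ q + d =
    -- q * (1 + ε)`.
    rcases Nat.eq_zero_or_pos n with h0 | h0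
    · subst h0
      have h1 : q ≤ q ^ (2 * d) := le_self_pow₀ hq1.le (by omega)
      simp only [zero_add, Nat.choose_one_right, pow_one]
      push_cast
      nlinarith
    · have h1 : (1 : ℝ) ≤ n := by exact_mod_cast h0
      have h2 : ((d + (n + 1)).choose (n + 1) : ℝ) ≤ ((n : ℝ) + 1 + 1) ^ d := by
        exact_mod_cast choose_add_le_pow (n + 1) d
      have h3 : ((n : ℝ) + 1 + 1) ^ d ≤ (q ^ 2) ^ d :=
        pow_le_pow_left₀ (by positivity) (by nlinarith) _
      rw [← pow_mul] at h3
      have : (0 : ℝ) ≤ q ^ (2 * d) := by positivity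
      nlinarith

/-- Each such set is listed by `d` slots, every slot holding an element or left empty. -/
theorem card_filter_card_le_le_pow (M d : ℕ) :
    ((Finset.univ : Finset (Finset (Fin M))).filter fun S => S.card ≤ d).card ≤ (M + 1) ^ d := by
  classical
  have h : Fintype.card (Fin d → Option (Fin M)) = (M + 1) ^ d := by simp
  rw [← h, ← Finset.card_univ]
  refine Finset.card_le_card_of_surjOn
    (fun g => Finset.univ.filter fun i => ∃ k, g k = some i) fun S hS => ?_
  simp only [Finset.coe_filter, Finset.mem_univ, true_and, Set.mem_ofPred_eq] at hS
  refine ⟨fun k => if hk : (k : ℕ) < S.card then some (S.equivFin.symm ⟨k, hk⟩) else none, by simp,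
    ?_⟩
  ext i
  simp only [Finset.mem_filter, Finset.mem_univ, true_and]
  constructor
  · rintro ⟨k, hk⟩
    split_ifs at hk with h1
    rw [Option.some_inj] at hk
    rw [← hk]
    exact Finset.coe_mem _
  · intro hi
    refine ⟨⟨S.equivFin ⟨i, hi⟩, (S.equivFin ⟨i, hi⟩).2.trans_le hS⟩, ?_⟩
    simp

/-! ### Set functions of low degree and block substitution -/

/-- The coefficients of a set function of degree at most `d` are controlled by its values on the
sets with at most `d` elements. -/
theorem exists_coeff_bound (d : ℕ) : ∃ c : ℝ, 0 ≤ c ∧ ∀ {ι : Type} [DecidableEq ι]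
    (a : Finset ι → ℂ) (M : ℝ), 0 ≤ M →
    (∀ S : Finset ι, S.card ≤ d → ‖∑ T ∈ S.powerset, a T‖ ≤ M) →
    ∀ T : Finset ι, T.card ≤ d → ‖a T‖ ≤ c * M := by
  induction d with
  | zero =>
    refine ⟨1, zero_le_one, fun a M _ h T hT => ?_⟩
    have h0 := h ∅ (by simp)
    rw [Finset.card_eq_zero.1 (Nat.le_zero.1 hT), one_mul]
    simpa using h0
  | succ d ih =>
    obtain ⟨c, hc, hcb⟩ := ih
    refine ⟨1 + 2 ^ (d + 1) * c, by positivity, fun a M hM h T hT => ?_⟩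
    have hsm := hcb a M hM fun S hS => h S (hS.trans (Nat.le_succ d))
    -- Inductive Möbius inversion: proper subsets of `T` have at most `d` elements, so their
    -- coefficients are already bounded.
    have hsplit : a T = ∑ S ∈ T.powerset, a S - ∑ S ∈ T.ssubsets, a S := by
      rw [Finset.ssubsets, ← Finset.add_sum_erase _ _ (Finset.mem_powerset_self T)]
      ring
    have hss : ‖∑ S ∈ T.ssubsets, a S‖ ≤ 2 ^ (d + 1) * c * M := by
      have h1 : ‖∑ S ∈ T.ssubsets, a S‖ ≤ ∑ S ∈ T.ssubsets, c * M :=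
        norm_sum_le_of_le _ fun S hS => hsm S (Nat.lt_succ_iff.1
          ((Finset.card_lt_card (Finset.mem_ssubsets.1 hS)).trans_le hT))
      have h2 : T.ssubsets.card ≤ 2 ^ (d + 1) := by
        refine (Finset.card_le_card (Finset.erase_subset _ _)).trans ?_
        rw [Finset.card_powerset]
        exact Nat.pow_le_pow_right two_pos hT
      have h3 : (T.ssubsets.card : ℝ) ≤ 2 ^ (d + 1) := by exact_mod_cast h2
      rw [Finset.sum_const, nsmul_eq_mul] at h1
      rw [mul_assoc]
      exact h1.trans (mul_le_mul_of_nonneg_right h3 (by positivity))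
    rw [hsplit]
    refine (norm_sub_le _ _).trans ?_
    linarith [h T hT]

/-- Replacing blocks of coordinates of `b` by those of `x`, a polynomial becomes a set function of
degree at most its total degree. -/
theorem exists_set_function_expansion {n M : ℕ} (c : Fin n → Fin M) (x b : Fin n → ℂ)
    (f : MvPolynomial (Fin n) ℂ) :
    ∃ a : Finset (Fin M) → ℂ, (∀ T, f.totalDegree < T.card → a T = 0) ∧
      ∀ S : Finset (Fin M), MvPolynomial.eval (fun j => if c j ∈ S then x j else b j) f =
        ∑ T ∈ S.powerset, a T := by
  classical
  -- `P y m i` is the part of the monomial `m` living on block `i`. The coefficients come from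
  -- expanding the product over blocks of `(P x - P b) + P b`; a block that `m` does not meet has
  -- zero difference, which bounds the degree.
  let P : (Fin n → ℂ) → (Fin n →₀ ℕ) → Fin M → ℂ := fun y m i =>
    ∏ j ∈ Finset.univ.filter (fun j => c j = i), y j ^ m j
  refine ⟨fun T => ∑ m ∈ f.support, f.coeff m *
    ((∏ i ∈ T, (P x m i - P b m i)) * ∏ i ∈ Finset.univ \ T, P b m i), fun T hT => ?_, fun S => ?_⟩
  · refine Finset.sum_eq_zero fun m hm => ?_
    have hsupp : (m.support.image c).card < T.card := by
      refine lt_of_le_of_lt (Finset.card_image_le.trans ?_) hT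
      have h := MvPolynomial.le_totalDegree hm
      refine le_trans ?_ h
      rw [Finset.card_eq_sum_ones]
      exact Finset.sum_le_sum fun j hj => Nat.one_le_iff_ne_zero.2 (Finsupp.mem_support_iff.1 hj)
    obtain ⟨i, hiT, hi⟩ := Finset.exists_mem_notMem_of_card_lt_card hsupp
    have hP : ∀ y, P y m i = 1 := fun y => Finset.prod_eq_one fun j hj => by
      have : m j = 0 := by
        by_contra h0
        exact hi (Finset.mem_image.2 ⟨j, Finsupp.mem_support_iff.2 h0, (Finset.mem_filter.1 hj).2⟩)
      rw [this, pow_zero]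
    rw [Finset.prod_eq_zero hiT (by rw [hP, hP, sub_self]), zero_mul, mul_zero]
  · rw [Finset.sum_comm, MvPolynomial.eval_eq']
    refine Finset.sum_congr rfl fun m _ => ?_
    rw [← Finset.mul_sum]
    congr 1
    have h1 : ∏ j, (if c j ∈ S then x j else b j) ^ m j =
        ∏ i, ((if i ∈ S then P x m i - P b m i else 0) + P b m i) := by
      rw [← Finset.prod_fiberwise Finset.univ c]
      refine Finset.prod_congr rfl fun i _ => ?_
      split_ifs with hi
      · rw [sub_add_cancel]
        refine Finset.prod_congr rfl fun j hj => ?_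
        rw [(Finset.mem_filter.1 hj).2, if_pos hi]
      · rw [zero_add]
        refine Finset.prod_congr rfl fun j hj => ?_
        rw [(Finset.mem_filter.1 hj).2, if_neg hi]
    rw [h1, Finset.prod_add]
    symm
    refine Finset.sum_subset_zero_on_sdiff (Finset.powerset_mono.2 (Finset.subset_univ S)) ?_ ?_
    · intro T hT
      simp only [Finset.mem_sdiff, Finset.mem_powerset] at hT
      obtain ⟨i, hiT, hiS⟩ := Finset.not_subset.1 hT.2
      rw [Finset.prod_eq_zero hiT (if_neg hiS), zero_mul]
    · intro T hT
      congr 1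
      exact Finset.prod_congr rfl fun i hi => (if_pos (Finset.mem_powerset.1 hT hi)).symm

/-- A subset of a product set, obtained by varying at most `d` of `M` blocks of coordinates, that
is norming for polynomials of degree at most `d`. -/
theorem exists_block_norming_const (d : ℕ) : ∃ c : ℝ, 0 ≤ c ∧
    ∀ (K n M : ℕ) (Z : Fin n → Finset ℂ), 1 ≤ K → 1 ≤ M → (∀ j, (Z j).card = K) →
    ∃ Y ⊆ Fintype.piFinset Z, Y.card ≤ (M + 1) ^ d * K ^ (d * (n / M + 1)) ∧
      ∀ f : MvPolynomial (Fin n) ℂ, f.totalDegree ≤ d → ∀ B : ℝ, 0 ≤ B →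
      (∀ y ∈ Y, ‖MvPolynomial.eval y f‖ ≤ B) →
      ∀ x ∈ Fintype.piFinset Z, ‖MvPolynomial.eval x f‖ ≤ (M + 1) ^ d * c * B := by
  classical
  obtain ⟨c, hc, hcb⟩ := exists_coeff_bound d
  refine ⟨c, hc, fun K n M Z hK hM hcard => ?_⟩
  have hne : ∀ j, (Z j).Nonempty := fun j => Finset.card_pos.1 (by rw [hcard]; omega)
  choose b hb using hne
  -- The blocks are consecutive intervals of length `q`; `n < M * q`, so `M` of them suffice.
  set q := n / M + 1 with hq
  have hcol : ∀ j : Fin n, (j : ℕ) / q < M := fun j => by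
    rw [Nat.div_lt_iff_lt_mul (Nat.succ_pos _)]
    exact j.2.trans (Nat.lt_mul_div_succ n hM)
  let col : Fin n → Fin M := fun j => ⟨j / q, hcol j⟩
  have hfib : ∀ i : Fin M, (Finset.univ.filter fun j => col j = i).card ≤ q := fun i => by
    have : ((Finset.univ.filter fun j => col j = i).map Fin.valEmbedding) ⊆
        Finset.Ico (i * q) (i * q + q) := by
      intro k hk
      obtain ⟨j, hj, rfl⟩ := Finset.mem_map.1 hk
      have h1 : (j : ℕ) / q = i := congrArg Fin.val (Finset.mem_filter.1 hj).2
      have h2 := Nat.div_add_mod (j : ℕ) q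
      have h3 : (j : ℕ) % q < q := Nat.mod_lt _ (Nat.succ_pos _)
      rw [h1, mul_comm] at h2
      simp only [Fin.valEmbedding_apply, Finset.mem_Ico]
      omega
    simpa using Finset.card_le_card this
  let small : Finset (Finset (Fin M)) := Finset.univ.filter fun S => S.card ≤ d
  let part : Finset (Fin M) → Finset (Fin n → ℂ) := fun S =>
    Fintype.piFinset fun j => if col j ∈ S then Z j else {b j}
  have hpart : ∀ S ∈ small, (part S).card ≤ K ^ (d * q) := fun S hS => by
    have h1 : (part S).card = K ^ (Finset.univ.filter fun j => col j ∈ S).card := by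
      rw [Fintype.card_piFinset, ← Finset.prod_const, Finset.prod_filter]
      refine Finset.prod_congr rfl fun j _ => ?_
      split_ifs
      · exact hcard j
      · exact Finset.card_singleton _
    rw [h1]
    refine Nat.pow_le_pow_right hK ?_
    have h2 : (Finset.univ.filter fun j => col j ∈ S) =
        S.biUnion fun i => Finset.univ.filter fun j => col j = i := by
      ext j; simp
    rw [h2]
    refine (Finset.card_biUnion_le_card_mul _ _ q fun i _ => hfib i).trans ?_
    exact Nat.mul_le_mul_right _ (Finset.mem_filter.1 hS).2
  refine ⟨small.biUnion part, ?_, ?_, fun f hf B hB hfB x hx => ?_⟩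
  · refine Finset.biUnion_subset.2 fun S _ y hy => Fintype.mem_piFinset.2 fun j => ?_
    have := Fintype.mem_piFinset.1 hy j
    split_ifs at this
    · exact this
    · rw [Finset.mem_singleton.1 this]
      exact hb j
  · exact (Finset.card_biUnion_le_card_mul _ _ _ hpart).trans
      (Nat.mul_le_mul_right _ (card_filter_card_le_le_pow M d))
  · obtain ⟨a, ha0, ha⟩ := exists_set_function_expansion col x b f
    have hab := hcb a B hB fun S hS => by
      rw [← ha]
      refine hfB _ (Finset.mem_biUnion.2 ⟨S, by simp [small, hS], Fintype.mem_piFinset.2 fun j => ?_⟩)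
      split_ifs
      · exact Fintype.mem_piFinset.1 hx j
      · exact Finset.mem_singleton_self _
    have hx' : MvPolynomial.eval x f = ∑ T ∈ small, a T := by
      -- Taking every block from `x` recovers `f x` as the sum of all coefficients, of which only
      -- those of size at most `d` survive.
      have h1 := ha Finset.univ
      simp only [Finset.mem_univ, if_true] at h1
      rw [h1, Finset.powerset_univ]
      symm
      refine Finset.sum_subset (Finset.subset_univ _) fun T _ hT => ha0 T ?_
      have : ¬ T.card ≤ d := fun h => hT (by simp [small, h])
      omega
    rw [hx']
    have h1 : ‖∑ T ∈ small, a T‖ ≤ ∑ T ∈ small, c * B :=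
      norm_sum_le_of_le _ fun T hT => hab T (Finset.mem_filter.1 hT).2
    rw [Finset.sum_const, nsmul_eq_mul] at h1
    have h2 : (small.card : ℝ) ≤ ((M : ℝ) + 1) ^ d := by
      exact_mod_cast card_filter_card_le_le_pow M d
    rw [mul_assoc]
    exact h1.trans (mul_le_mul_of_nonneg_right h2 (by positivity))

/-! ### Choice of parameters and size of the constant -/

/-- The number of blocks used at level `ε`. -/
noncomputable def blockCount (d K : ℕ) (ε : ℝ) : ℕ :=
  ⌈2 * d * Real.log K / Real.log (1 + ε)⌉₊ + 1

/-- The number of variables from which on the block construction is small enough. -/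
noncomputable def blockThreshold (d K : ℕ) (ε : ℝ) : ℕ :=
  ⌈2 * d * Real.log (K * (blockCount d K ε + 1)) / Real.log (1 + ε)⌉₊

/-- The factors `2` in `blockCount` and `blockThreshold` split the budget: `K ^ (d * (n / M))` and
`(K * (M + 1)) ^ d` are each at most `(1 + ε) ^ (n / 2)`, with a real exponent `n / 2` here. -/
theorem block_card_le {d K n : ℕ} (hK : 1 ≤ K) {ε : ℝ} (hε : 0 < ε)
    (hn : blockThreshold d K ε ≤ n) :
    ((blockCount d K ε : ℝ) + 1) ^ d * (K : ℝ) ^ (d * (n / blockCount d K ε + 1)) ≤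
      (1 + ε) ^ n := by
  set M := blockCount d K ε with hM
  set k := n / M with hk
  have hl : 0 < Real.log (1 + ε) := Real.log_pos (by linarith)
  have hK0 : (0 : ℝ) < K := by exact_mod_cast hK
  have hlK : 0 ≤ Real.log K := Real.log_natCast_nonneg K
  have hM0 : (0 : ℝ) < (M : ℝ) + 1 := by positivity
  have h1 : 2 * d * Real.log K ≤ M * Real.log (1 + ε) := by
    rw [← div_le_iff₀ hl, hM, blockCount]
    push_cast
    exact (Nat.le_ceil _).trans (by linarith)
  have h2 : 2 * d * Real.log (K * (M + 1)) ≤ n * Real.log (1 + ε) := by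
    rw [← div_le_iff₀ hl]
    exact (Nat.le_ceil _).trans (Nat.cast_le.2 hn)
  rw [Real.log_mul hK0.ne' hM0.ne'] at h2
  have h3 : (k : ℝ) * M ≤ n := by exact_mod_cast Nat.div_mul_le_self n M
  have h4 : (k : ℝ) * (2 * d * Real.log K) ≤ n * Real.log (1 + ε) :=
    calc (k : ℝ) * (2 * d * Real.log K) ≤ k * (M * Real.log (1 + ε)) :=
          mul_le_mul_of_nonneg_left h1 (Nat.cast_nonneg _)
      _ = (k * M) * Real.log (1 + ε) := by ring
      _ ≤ _ := mul_le_mul_of_nonneg_right h3 hl.le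
  rw [← Real.log_le_log_iff (by positivity) (by positivity), Real.log_mul (by positivity)
    (by positivity), Real.log_pow, Real.log_pow, Real.log_pow]
  push_cast
  linarith

/-- The comparison constant, in terms of the constants of the discretization and block estimates. -/
noncomputable def normingConst (d K : ℕ) (A c ε : ℝ) : ℝ :=
  A * (2 ^ (blockThreshold d K ε + 1) ^ d + ((blockCount d K ε : ℝ) + 1) ^ d * c)

/-- As `log (1 + ε) ≥ ε / 2`, the block count is `O(ε⁻¹)` and the threshold `O(ε⁻¹ log ε⁻¹)`. The
restriction `ε ≤ 1 / 2` keeps `log ε⁻¹ ≥ 1 / 2`, so additive constants are absorbed. -/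
theorem exists_normingConst_le (d K : ℕ) (hK : 1 ≤ K) (A c : ℝ) (hA : 0 ≤ A) (hc : 0 ≤ c) :
    ∃ C₃ : ℝ, ∀ ε : ℝ, 0 < ε → ε ≤ 1 / 2 →
      normingConst d K A c ε ≤ Real.exp (C₃ * (ε⁻¹ * Real.log ε⁻¹) ^ d) := by
  have hlK : 0 ≤ Real.log K := Real.log_natCast_nonneg K
  have hK1 : (1 : ℝ) ≤ K := by exact_mod_cast hK
  set c₁ : ℝ := 4 * d * Real.log K + 3 with hc₁
  have hc₁1 : 1 ≤ c₁ := by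
    have : 0 ≤ 4 * d * Real.log K := by positivity
    linarith
  have hlc : 0 ≤ Real.log (K * c₁) := Real.log_nonneg (one_le_mul_of_one_le_of_one_le hK1 hc₁1)
  set c₂ : ℝ := 4 * d * (2 * Real.log (K * c₁) + 1) + 2 with hc₂
  have hc₂0 : 0 ≤ c₂ := by positivity
  -- The summands pay for `A ≤ exp A`, the dimension term, the block term, and `exp u + exp v ≤ exp
  -- (u + v + 1)`; those not carrying `L ^ d` use `L ^ d ≥ 1`.
  refine ⟨A + (c₂ ^ d + c * (2 * c₁) ^ d + 1), fun ε hε hε2 => ?_⟩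
  set l := Real.log ε⁻¹ with hl
  have hinv : 2 ≤ ε⁻¹ := by
    rw [le_inv_comm₀ two_pos hε]
    linarith
  have hl2 : 1 / 2 ≤ l := by
    have := Real.log_le_log two_pos hinv
    have := Real.log_two_gt_d9
    linarith
  set L := ε⁻¹ * l with hL
  have hinvL : ε⁻¹ ≤ 2 * L := by nlinarith
  have hL1 : 1 ≤ L := by linarith
  have hlam : ε / 2 ≤ Real.log (1 + ε) := by
    refine le_trans ?_ (Real.le_log_one_add_of_nonneg hε.le)
    rw [div_le_div_iff₀ two_pos (by linarith)]
    nlinarith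
  have hdiv : ∀ x : ℝ, 0 ≤ x → x / Real.log (1 + ε) ≤ 2 * x * ε⁻¹ := fun x hx => by
    calc x / Real.log (1 + ε) ≤ x / (ε / 2) := div_le_div_of_nonneg_left hx (by positivity) hlam
      _ = 2 * x * ε⁻¹ := by field_simp
  have hM : (blockCount d K ε : ℝ) + 1 ≤ c₁ * ε⁻¹ := by
    have h1 : (blockCount d K ε : ℝ) ≤ 2 * d * Real.log K / Real.log (1 + ε) + 1 + 1 := by
      rw [blockCount]
      push_cast
      have hpos : 0 ≤ 2 * d * Real.log K / Real.log (1 + ε) :=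
        div_nonneg (by positivity) (le_trans (by positivity) hlam)
      linarith [Nat.ceil_lt_add_one hpos]
    have h2 := hdiv (2 * d * Real.log K) (by positivity)
    rw [hc₁]
    nlinarith
  have hM0 : (0 : ℝ) < (blockCount d K ε : ℝ) + 1 := by positivity
  have hN : (blockThreshold d K ε : ℝ) + 1 ≤ c₂ * L := by
    have hlog : Real.log (K * (blockCount d K ε + 1)) ≤ (2 * Real.log (K * c₁) + 1) * l := by
      have h1 : Real.log (K * (blockCount d K ε + 1)) ≤ Real.log ((K * c₁) * ε⁻¹) := by
        refine Real.log_le_log (by positivity) ?_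
        rw [mul_assoc]
        exact mul_le_mul_of_nonneg_left hM (by positivity)
      rw [Real.log_mul (x := K * c₁) (by positivity) (by positivity)] at h1
      nlinarith
    have hlog0 : 0 ≤ Real.log (K * (blockCount d K ε + 1)) :=
      Real.log_nonneg (one_le_mul_of_one_le_of_one_le hK1
        (le_add_of_nonneg_left (Nat.cast_nonneg _)))
    have h2 := hdiv (2 * d * Real.log (K * (blockCount d K ε + 1))) (by positivity)
    have hpos : 0 ≤ 2 * d * Real.log (K * (blockCount d K ε + 1)) / Real.log (1 + ε) :=
      div_nonneg (by positivity) (le_trans (by positivity) hlam)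
    have h3 : (blockThreshold d K ε : ℝ) <
        2 * d * Real.log (K * (blockCount d K ε + 1)) / Real.log (1 + ε) + 1 :=
      Nat.ceil_lt_add_one hpos
    have h4 : 2 * (2 * d * Real.log (K * (blockCount d K ε + 1))) * ε⁻¹ ≤
        4 * d * ((2 * Real.log (K * c₁) + 1) * l) * ε⁻¹ := by
      refine mul_le_mul_of_nonneg_right ?_ (by positivity)
      have := mul_le_mul_of_nonneg_left hlog (by positivity : (0 : ℝ) ≤ 4 * d)
      linarith
    have h5 : c₂ * L = 4 * d * ((2 * Real.log (K * c₁) + 1) * l) * ε⁻¹ + 2 * L := by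
      rw [hc₂, hL]; ring
    linarith
  have hLd : 1 ≤ L ^ d := one_le_pow₀ hL1
  have b1 : (2 : ℝ) ^ (blockThreshold d K ε + 1) ^ d ≤ Real.exp (c₂ ^ d * L ^ d) := by
    have h2e : (2 : ℝ) ≤ Real.exp 1 := by linarith [Real.add_one_le_exp (1 : ℝ)]
    calc (2 : ℝ) ^ (blockThreshold d K ε + 1) ^ d
        ≤ Real.exp 1 ^ (blockThreshold d K ε + 1) ^ d := pow_le_pow_left₀ two_pos.le h2e _
      _ = Real.exp (((blockThreshold d K ε : ℝ) + 1) ^ d) := by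
          rw [← Real.exp_nat_mul, mul_one]
          push_cast
          rfl
      _ ≤ _ := by
          rw [← mul_pow]
          exact Real.exp_le_exp.2 (pow_le_pow_left₀ (by positivity) hN d)
  have b2 : ((blockCount d K ε : ℝ) + 1) ^ d * c ≤ Real.exp (c * (2 * c₁) ^ d * L ^ d) := by
    have h1 : ((blockCount d K ε : ℝ) + 1) ^ d ≤ (2 * c₁ * L) ^ d :=
      pow_le_pow_left₀ hM0.le (hM.trans (by nlinarith)) d
    have h2 := mul_le_mul_of_nonneg_right h1 hc
    rw [mul_pow] at h2
    have h3 := Real.add_one_le_exp (c * (2 * c₁) ^ d * L ^ d)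
    linarith
  set u := c₂ ^ d * L ^ d with hu
  set v := c * (2 * c₁) ^ d * L ^ d with hv
  have hu0 : 0 ≤ u := by positivity
  have hv0 : 0 ≤ v := by positivity
  have b3 : Real.exp u + Real.exp v ≤ Real.exp (u + v + 1) := by
    have e1 : Real.exp u ≤ Real.exp (u + v) := Real.exp_le_exp.2 (by linarith)
    have e2 : Real.exp v ≤ Real.exp (u + v) := Real.exp_le_exp.2 (by linarith)
    rw [Real.exp_add (u + v) 1]
    nlinarith [Real.add_one_le_exp (1 : ℝ), Real.exp_pos (u + v)]
  have b4 : A ≤ Real.exp A := by linarith [Real.add_one_le_exp A]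
  calc normingConst d K A c ε ≤ Real.exp A * Real.exp (u + v + 1) := by
        rw [normingConst]
        exact mul_le_mul b4 ((add_le_add b1 b2).trans b3) (by positivity) (Real.exp_pos _).le
    _ = Real.exp (A + (u + v + 1)) := (Real.exp_add _ _).symm
    _ ≤ _ := by
        refine Real.exp_le_exp.2 ?_
        rw [hu, hv]
        nlinarith

/-! ### Uniform norms and the main theorem -/

theorem uniformNorm_nonneg {n : ℕ} (S : Set (Fin n → ℂ)) (f : MvPolynomial (Fin n) ℂ) :
    0 ≤ uniformNorm S f :=
  Real.iSup_nonneg fun _ => norm_nonneg _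

theorem norm_eval_le_uniformNorm {n : ℕ} (Y : Finset (Fin n → ℂ)) (f : MvPolynomial (Fin n) ℂ)
    {y : Fin n → ℂ} (hy : y ∈ Y) : ‖MvPolynomial.eval y f‖ ≤ uniformNorm (Y : Set (Fin n → ℂ)) f :=
  le_ciSup (f := fun z : (Y : Set (Fin n → ℂ)) => ‖MvPolynomial.eval (z : Fin n → ℂ) f‖)
    (Set.finite_range _).bddAbove ⟨y, hy⟩

theorem theorem2p1 (d K : ℕ) (hK : 2 ≤ K) (η : ℝ) (hη : 0 < η) :
    ∃ C₃ : ℝ, ∀ ε : ℝ, 0 < ε →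
      ∃ C₂ : ℝ,
        (ε ≤ 1 / 2 → C₂ ≤ Real.exp (C₃ * (ε⁻¹ * Real.log ε⁻¹) ^ d)) ∧
        ∀ (n : ℕ) (Z : Fin n → Finset ℂ),
          (∀ j, ∀ z ∈ Z j, ‖z‖ ≤ 1) →
          (∀ j, (Z j).card = K) →
          (∀ j, ∀ z ∈ Z j, ∀ z' ∈ Z j, z ≠ z' → η ≤ ‖z - z'‖) →
          ∃ Y : Finset (Fin n → ℂ),
            (∀ y ∈ Y, ∀ j, y j ∈ Z j) ∧
            (Y.card : ℝ) ≤ (max 1 ((d : ℝ) / ε)) ^ (100 * d) * (1 + ε) ^ n ∧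
            ∀ f : MvPolynomial (Fin n) ℂ,
              f.totalDegree ≤ d → (∀ j, f.degreeOf j ≤ K - 1) →
              uniformNorm (polydisc n) f ≤ C₂ * uniformNorm (Y : Set (Fin n → ℂ)) f := by
  have hK1 : 1 ≤ K := one_le_two.trans hK
  obtain ⟨A, hA, hdisc⟩ := exists_discretization_const d K hK1 hη
  obtain ⟨c, hc, hblock⟩ := exists_block_norming_const d
  obtain ⟨C₃, hC₃⟩ := exists_normingConst_le d K hK1 A c hA hc
  refine ⟨C₃, fun ε hε => ⟨normingConst d K A c ε, hC₃ ε hε, fun n Z hZ hcard hsep => ?_⟩⟩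
  set N := blockThreshold d K ε with hN
  set M := blockCount d K ε with hM
  have hmax : 1 ≤ max 1 ((d : ℝ) / ε) := le_max_left _ _
  have hpow : 0 ≤ (1 + ε) ^ n := by positivity
  -- it suffices to find a small subset that is norming on the product set
  suffices h : ∃ Y ⊆ Fintype.piFinset Z,
      (Y.card : ℝ) ≤ (max 1 ((d : ℝ) / ε)) ^ (100 * d) * (1 + ε) ^ n ∧
      ∀ f : MvPolynomial (Fin n) ℂ, f.totalDegree ≤ d → ∀ B : ℝ, 0 ≤ B →
      (∀ y ∈ Y, ‖MvPolynomial.eval y f‖ ≤ B) → ∀ x ∈ Fintype.piFinset Z,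
        ‖MvPolynomial.eval x f‖ ≤ (2 ^ (N + 1) ^ d + ((M : ℝ) + 1) ^ d * c) * B by
    obtain ⟨Y, hYZ, hYc, hY⟩ := h
    refine ⟨Y, fun y hy j => Fintype.mem_piFinset.1 (hYZ hy) j, hYc, fun f hfd hfK => ?_⟩
    have hB := uniformNorm_nonneg (Y : Set (Fin n → ℂ)) f
    have hC : 0 ≤ normingConst d K A c ε := by
      rw [normingConst]
      positivity
    refine Real.iSup_le (fun z => ?_) (mul_nonneg hC hB)
    rw [normingConst, mul_assoc]
    exact hdisc n Z hZ hcard hsep f hfd hfK _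
      (hY f hfd _ hB fun y hy => norm_eval_le_uniformNorm Y f hy) z z.2
  -- Above the threshold the block set has at most `(1 + ε) ^ n` points. Below it the dimension is
  -- at most `(N + 1) ^ d`, and an exponent `2 * d` already suffices in the cardinality bound.
  rcases le_or_gt N n with hn | hn
  · obtain ⟨Y, hYZ, hYc, hY⟩ := hblock K n M Z hK1 (Nat.succ_pos _) hcard
    refine ⟨Y, hYZ, ?_, fun f hf B hB hfB x hx => (hY f hf B hB hfB x hx).trans ?_⟩
    · have h1 : (Y.card : ℝ) ≤ ((M : ℝ) + 1) ^ d * (K : ℝ) ^ (d * (n / M + 1)) := by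
        exact_mod_cast hYc
      exact (h1.trans (block_card_le hK1 hε hn)).trans
        (le_mul_of_one_le_left hpow (one_le_pow₀ hmax))
    · exact mul_le_mul_of_nonneg_right (le_add_of_nonneg_left (by positivity)) hB
  · obtain ⟨Y, hYZ, hYc, hY⟩ := exists_norming_subset_totalDegree d (Fintype.piFinset Z)
    refine ⟨Y, hYZ, ?_, fun f hf B hB hfB x hx => (hY f hf B hB hfB x hx).trans ?_⟩
    · have h1 : (Y.card : ℝ) ≤ ((d + n).choose n : ℝ) := by exact_mod_cast hYc
      refine (h1.trans (choose_add_le_max_pow_mul d n hε)).trans ?_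
      exact mul_le_mul_of_nonneg_right (pow_le_pow_right₀ hmax (by omega)) hpow
    · refine mul_le_mul_of_nonneg_right (le_add_of_le_of_nonneg ?_ (by positivity)) hB
      refine pow_le_pow_right₀ one_le_two ((choose_add_le_pow n d).trans ?_)
      exact Nat.pow_le_pow_left (by omega) d
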